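/- Let $n\ge 0$ be an integer and let $\mathbf R^{(n)}$ be the $n$-fold symmetric product of the real line, whose points are the divisors $\sum_i k_i x_i$ on $\mathbf R$ with integer multiplicities $k_i\ge 0$ and $\sum_i k_i=n$, with the quotient topology from $\mathbf R^n$. Let $S(n,1)\subset \mathbf R^{(n)}\times\mathbf R^{(n)}$ be the subspace of pairs of divisors with disjoint supports. Let $T(n,1)$ be the quotient space (with the quotient topology) of $S(n,1)$ by the equivalence relation that identifies two pairs $(D_0,D_1)$ and $(E_0,E_1)$ if, for $p=0,1$ and every $x\in\mathbf R$, the multiplicities of $x$ in $D_p$ and in $E_p$ are congruent modulo $2$. Then every connected component of $T(n,1)$ is contractible. -/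

import Mathlib

/-- The `n`-fold symmetric product of the real line: unordered `n`-tuples of real points counted
with multiplicity, i.e. effective divisors of degree `n` on `ℝ`. -/
def RealDivisor (n : ℕ) : Type := Sym ℝ n

namespace RealDivisor

/-- The multiplicity of the point `x` in the divisor `D`. -/
noncomputable def mult {n : ℕ} (D : RealDivisor n) (x : ℝ) : ℕ :=
  Multiset.count x D.1

/-- The support of a divisor: the points of positive multiplicity. -/
def support {n : ℕ} (D : RealDivisor n) : Set ℝ :=
  {x | 0 < D.mult x}

/-- The divisor `x₁ + ⋯ + xₙ` of an ordered `n`-tuple of real points. -/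
def ofTuple {n : ℕ} (x : Fin n → ℝ) : RealDivisor n :=
  ⟨Finset.univ.val.map x, by simp⟩

/-- The symmetric product carries the quotient topology from `ℝⁿ`. -/
instance (n : ℕ) : TopologicalSpace (RealDivisor n) :=
  TopologicalSpace.coinduced ofTuple inferInstance

end RealDivisor

/-- The space `S(n,m)` of `(m+1)`-tuples of real divisors of degree `n` on `ℝ` with no point common
to the supports of all `m+1` divisors, as a subspace of the `(m+1)`-fold Cartesian product. -/
abbrev DivisorCollection (n m : ℕ) : Type :=
  {D : Fin (m + 1) → RealDivisor n // ⋂ p, (D p).support = ∅}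

/-- Two collections of divisors are equivalent if all multiplicities agree modulo `2`. -/
def mod2Setoid (n m : ℕ) : Setoid (DivisorCollection n m) where
  r D E := ∀ (p : Fin (m + 1)) (x : ℝ), (D.1 p).mult x ≡ (E.1 p).mult x [MOD 2]
  iseqv :=
    { refl := fun _ _ _ => Nat.ModEq.refl _
      symm := fun h p x => (h p x).symm
      trans := fun h k p x => (h p x).trans (k p x) }

/-- The configuration space `T(n,m)` of mod 2 particles on the real line. -/
def ParticleSpace (n m : ℕ) : Type := Quotient (mod2Setoid n m)

/-- `T(n,m)` carries the quotient topology from `S(n,m)`. -/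
instance (n m : ℕ) : TopologicalSpace (ParticleSpace n m) :=
  inferInstanceAs (TopologicalSpace (Quotient (mod2Setoid n m)))

/-! Colour the edge `{m - 1, m}` of `ℤ` by `m` mod 2, so that every vertex meets one edge of each
colour. Read from left to right, the `2n` coloured particles drive a walk from `0`, each particle
crossing the edge of its colour. Two neighbours of one colour cross the same edge to and fro, just
as they cancel in `T(n,1)`. Let `k` be the final vertex. A particle opens a gap on its edge `e` if
after its step `e` separates the walk from `k`; the next crossing of `e` closes that gap.

Let every particle move right at unit speed until it has covered its gap length, the total length of
later intervals on which its edge separates the walk from `k`. The opener and the closer of a gap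
then stop at the same place and cancel, while uncancelled particles of different colours never meet
(`Sorted.flow_lt`). After all cancellations the remaining edges lie between `0` and `k` and are
crossed in order of `|e|` (`abs_edge_lt`), so each particle can move linearly to `|e|`. This end
position depends only on the order of the colours.

The motion descends to `T(n,1)` because edges and gap lengths are alternating sums over the
particles, which see multiplicities only modulo 2 (`ParityEq.signed_sum_eq`, `ParityEq.move`). It is
continuous because cancelled particles form an even set of each colour, also nearby, and may be
parked far away (`exists_continuousAt_represents`). The result is a homotopy from the identity of
`T(n,1)` to a locally constant map, which contracts each component. -/

open Finset Topology

/-! ### The walk on `ℤ`, gap lengths and cancellation -/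

namespace ParticleWord

/-- The direction of the `q`-th step of the walk on `ℤ` whose edge `{m - 1, m}` has colour
`m mod 2`. -/
def stepSign (c : ℕ → ℕ) (q : ℕ) : ℤ := (-1) ^ (q + 1 + c q)

/-- The position of the walk after `i` steps. -/
def height (c : ℕ → ℕ) (i : ℕ) : ℤ := ∑ q ∈ range i, stepSign c q

/-- Twice the midpoint of the edge crossed by the `i`-th step. -/
def edge (c : ℕ → ℕ) (i : ℕ) : ℤ := height c i + height c (i + 1)

/-- The edge with midpoint `e / 2` separates the vertices `v` and `k` of `ℤ`. -/
def Separates (k e v : ℤ) : Prop := (2 * v < e ∧ e < 2 * k) ∨ (2 * k < e ∧ e < 2 * v)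

instance (k e v : ℤ) : Decidable (Separates k e v) := by
  unfold Separates; infer_instance

/-- The total length of the intervals to the right of the `i`-th particle on which the walk is
separated by `e` from its final position. -/
def gapLength (c : ℕ → ℕ) (x : ℕ → ℝ) (N : ℕ) (e : ℤ) (i : ℕ) : ℝ :=
  ∑ q ∈ Ico i (N - 1), if Separates (height c N) e (height c (q + 1)) then x (q + 1) - x q else 0

/-- Particles `0, …, N - 1` are listed from left to right, and particles of different colours
are at different places. -/
structure Sorted (c : ℕ → ℕ) (x : ℕ → ℝ) (N : ℕ) : Prop where
  mono : ∀ a b, a ≤ b → b < N → x a ≤ x b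
  lt : ∀ a b, a < b → b < N → c a ≠ c b → x a < x b
  colour : ∀ a, c a < 2

variable {c : ℕ → ℕ} {x : ℕ → ℝ} {N : ℕ}

lemma stepSign_cases (c : ℕ → ℕ) (q : ℕ) :
    (stepSign c q = 1 ∧ (q + 1 + c q) % 2 = 0) ∨ (stepSign c q = -1 ∧ (q + 1 + c q) % 2 = 1) := by
  unfold stepSign
  rcases Nat.even_or_odd (q + 1 + c q) with h | h
  · left; exact ⟨h.neg_one_pow, Nat.even_iff.1 h⟩
  · right; exact ⟨h.neg_one_pow, Nat.odd_iff.1 h⟩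

lemma height_succ (c : ℕ → ℕ) (q : ℕ) : height c (q + 1) = height c q + stepSign c q :=
  sum_range_succ _ _

lemma height_parity (c : ℕ → ℕ) (i : ℕ) : height c i % 2 = i % 2 := by
  induction i with
  | zero => simp [height]
  | succ i ih =>
    rw [height_succ]
    rcases stepSign_cases c i with h | h <;> omega

/-- The vertex before step `i` has the parity of `i`, which is why the sign in `stepSign` selects
the edge of colour `c i`. Hence an edge determines the colour of its particles. -/
lemma edge_mod_four (c : ℕ → ℕ) (i : ℕ) : (4 : ℤ) ∣ edge c i - (2 * c i - 1) := by
  have h1 := height_parity c i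
  have h2 := height_succ c i
  unfold edge
  rcases stepSign_cases c i with h | h <;> omega

lemma edge_cases (c : ℕ → ℕ) (i : ℕ) :
    (edge c i = 2 * height c i + 1 ∧ height c (i + 1) = height c i + 1) ∨
      (edge c i = 2 * height c i - 1 ∧ height c (i + 1) = height c i - 1) := by
  have h2 := height_succ c i
  unfold edge
  rcases stepSign_cases c i with h | h <;> omega

lemma edge_odd (c : ℕ → ℕ) (i : ℕ) : edge c i % 2 = 1 := by
  rcases edge_cases c i with h | h <;> omega

lemma Sorted.colour_eq (h : Sorted c x N) {a b : ℕ} (hab : edge c a = edge c b) : c a = c b := by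
  have h1 := edge_mod_four c a
  have h2 := edge_mod_four c b
  have h3 := h.colour a
  have h4 := h.colour b
  omega

lemma edge_succ_eq {a : ℕ} (h : c a = c (a + 1)) : edge c (a + 1) = edge c a := by
  have h1 := height_succ c a
  have h2 := height_succ c (a + 1)
  unfold edge
  rcases stepSign_cases c a with h | h <;> rcases stepSign_cases c (a + 1) with h' | h' <;> omega

lemma separates_succ_iff {k e : ℤ} {q : ℕ} (he : e % 2 = 1) (hne : edge c q ≠ e) :
    Separates k e (height c (q + 1)) ↔ Separates k e (height c q) := by
  unfold Separates
  rcases edge_cases c q with h | h <;> omega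

lemma separates_succ_edge (k : ℤ) (q : ℕ) :
    Separates k (edge c q) (height c (q + 1)) ↔ ¬ Separates k (edge c q) (height c q) := by
  unfold Separates
  rcases edge_cases c q with h | h <;> omega

lemma not_separates_self (k e : ℤ) : ¬ Separates k e k := by
  unfold Separates; omega

/-- Only a crossing of `e` changes the side of `e`, so going back from `b` one either meets the
opener of the current gap or stays inside the gap down to `a`. -/
lemma exists_edge_or_forall_separates {k e : ℤ} (he : e % 2 = 1) (a b : ℕ) (hab : a ≤ b)
    (hb : Separates k e (height c b)) :
    (∃ q, a ≤ q ∧ q < b ∧ edge c q = e ∧ Separates k e (height c (q + 1))) ∨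
      ∀ q, a ≤ q → q ≤ b → Separates k e (height c q) := by
  induction b, hab using Nat.le_induction with
  | base => right; intro q h1 h2; rwa [le_antisymm h2 h1]
  | succ b hab ih =>
    by_cases hbe : edge c b = e
    · exact .inl ⟨b, hab, by omega, hbe, hb⟩
    · rcases ih ((separates_succ_iff he hbe).1 hb) with ⟨q, h1, h2, h3⟩ | h
      · exact .inl ⟨q, h1, by omega, h3⟩
      · right
        intro q h1 h2
        rcases h2.lt_or_eq with h2 | rfl
        · exact h q h1 (by omega)
        · exact hb

lemma forall_separates_of_no_edge {k e : ℤ} (he : e % 2 = 1) {a b : ℕ}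
    (ha : Separates k e (height c a)) (h : ∀ q, a ≤ q → q < b → edge c q ≠ e) :
    ∀ q, a ≤ q → q ≤ b → Separates k e (height c q) := by
  intro q h1
  induction q, h1 using Nat.le_induction with
  | base => exact fun _ => ha
  | succ q hq ih => exact fun h2 => (separates_succ_iff he (h q hq (by omega))).2 (ih (by omega))

lemma exists_next {a : ℕ} (haN : a < N) (ha : Separates (height c N) (edge c a) (height c (a + 1))) :
    ∃ b, (a < b ∧ b < N) ∧ edge c b = edge c a := by
  by_contra! h
  exact not_separates_self _ _ (forall_separates_of_no_edge (edge_odd c a) ha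
    (fun q h1 h2 => h q ⟨h1, h2⟩) N haN le_rfl)

section gap

lemma Sorted.gap_term_nonneg (h : Sorted c x N) {q : ℕ} (hq : q + 1 < N) (k e v : ℤ) :
    0 ≤ if Separates k e v then x (q + 1) - x q else 0 := by
  have := h.mono q (q + 1) (by omega) hq
  split_ifs <;> linarith

lemma Sorted.gap_term_le (h : Sorted c x N) {q : ℕ} (hq : q + 1 < N) (k e v : ℤ) :
    (if Separates k e v then x (q + 1) - x q else 0) ≤ x (q + 1) - x q := by
  have := h.mono q (q + 1) (by omega) hq
  split_ifs <;> linarith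

lemma Sorted.gapLength_nonneg (h : Sorted c x N) (e : ℤ) (i : ℕ) : 0 ≤ gapLength c x N e i :=
  sum_nonneg fun q hq => h.gap_term_nonneg (by have := mem_Ico.1 hq; omega) _ _ _

lemma gapLength_succ {i : ℕ} (hi : i + 1 < N) (e : ℤ) :
    gapLength c x N e i =
      (if Separates (height c N) e (height c (i + 1)) then x (i + 1) - x i else 0) +
        gapLength c x N e (i + 1) :=
  sum_eq_sum_Ico_succ_bot (by omega) _

lemma Sorted.gapLength_anti (h : Sorted c x N) (e : ℤ) {a b : ℕ} (hab : a ≤ b) (hb : b < N) :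
    gapLength c x N e b ≤ gapLength c x N e a := by
  induction b, hab using Nat.le_induction with
  | base => rfl
  | succ b hab ih =>
    have h1 := gapLength_succ (c := c) (x := x) hb e
    have h2 := h.gap_term_nonneg hb (height c N) e (height c (b + 1))
    have h3 := ih (by omega)
    linarith

lemma Sorted.gapLength_le (h : Sorted c x N) (e : ℤ) {a b : ℕ} (hab : a ≤ b) (hb : b < N) :
    gapLength c x N e a ≤ x b - x a + gapLength c x N e b := by
  induction b, hab using Nat.le_induction with
  | base => simp
  | succ b hab ih =>
    have h1 := gapLength_succ (c := c) (x := x) hb e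
    have h2 := h.gap_term_le hb (height c N) e (height c (b + 1))
    have h3 := ih (by omega)
    linarith

/-- For an opener `a` and its closer `b` this says that `x a` plus its gap length equals `x b` plus
its gap length: both are heading for the same place. -/
lemma gapLength_eq_of_separates {e : ℤ} {a b : ℕ} (hab : a ≤ b) (hb : b < N)
    (hs : ∀ q, a < q → q ≤ b → Separates (height c N) e (height c q)) :
    gapLength c x N e a = x b - x a + gapLength c x N e b := by
  induction b, hab using Nat.le_induction with
  | base => simp
  | succ b hab ih =>
    have h1 := gapLength_succ (c := c) (x := x) hb e
    rw [if_pos (hs (b + 1) (by omega) le_rfl)] at h1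
    have h3 := ih (by omega) fun q h1 h2 => hs q h1 (by omega)
    linarith

lemma Sorted.gapLength_mono (h : Sorted c x N) {e e' : ℤ}
    (hee : ∀ v, Separates (height c N) e v → Separates (height c N) e' v) (i : ℕ) :
    gapLength c x N e i ≤ gapLength c x N e' i := by
  refine sum_le_sum fun q hq => ?_
  have hq : q + 1 < N := by have := mem_Ico.1 hq; omega
  by_cases h1 : Separates (height c N) e (height c (q + 1))
  · rw [if_pos h1, if_pos (hee _ h1)]
  · rw [if_neg h1]; exact h.gap_term_nonneg hq _ _ _

end gap

/-- The gap length of the `i`-th particle with respect to the edge that it crosses. -/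
def gapAt (c : ℕ → ℕ) (x : ℕ → ℝ) (N : ℕ) (i : ℕ) : ℝ := gapLength c x N (edge c i) i

/-- Particle `i` lies at or after a particle on the same edge that opens a gap of length less
than `T`. -/
def Cancelled (c : ℕ → ℕ) (x : ℕ → ℝ) (N : ℕ) (T : ℝ) (i : ℕ) : Prop :=
  ∃ a ≤ i, edge c a = edge c i ∧ Separates (height c N) (edge c a) (height c (a + 1)) ∧
    gapAt c x N a < T

/-- Particles of different colours that have not been cancelled keep their order. -/
lemma Sorted.flow_lt (h : Sorted c x N) (T : ℝ) {a b : ℕ} (hab : a < b) (hb : b < N)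
    (hc : c a ≠ c b) (hnb : ¬ Cancelled c x N T b) :
    x a + min T (gapAt c x N a) < x b + min T (gapAt c x N b) := by
  have hxab := h.lt a b hab hb hc
  have heab : edge c a ≠ edge c b := fun he => hc (h.colour_eq he)
  rcases le_or_gt T (gapAt c x N b) with hT | hT
  · rw [min_eq_left hT]
    linarith [min_le_left T (gapAt c x N a)]
  rw [min_eq_right hT.le]
  -- From here `b` has already stopped; being uncancelled, it is not an opener, so it crosses its
  -- edge towards the final vertex.
  have hafter : ¬ Separates (height c N) (edge c b) (height c (b + 1)) :=
    fun hs => hnb ⟨b, le_rfl, rfl, hs, hT⟩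
  have hbefore : Separates (height c N) (edge c b) (height c b) := by
    by_contra h'; exact hafter ((separates_succ_edge _ _).2 h')
  rcases exists_edge_or_forall_separates (edge_odd c b) a b hab.le hbefore with
    ⟨q, haq, hqb, hqe, hqs⟩ | hall
  -- An opener `q` on the edge of `b` lies between `a` and `b`. It is uncancelled, so its gap is at
  -- least `T`, and `x a + T < x q + T ≤ x b + gapAt c x N b`.
  · have haq : a < q := lt_of_le_of_ne haq (by rintro rfl; exact heab hqe)
    have h1 : T ≤ gapAt c x N q := by
      by_contra! h'
      exact hnb ⟨q, hqb.le, hqe, hqe ▸ hqs, h'⟩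
    have h2 : x a < x q := h.lt a q haq (by omega) (by rw [h.colour_eq hqe]; exact hc)
    have h3 := h.gapLength_le (edge c b) hqb.le hb
    unfold gapAt at h1 ⊢
    rw [hqe] at h1
    linarith [min_le_left T (gapLength c x N (edge c a) a)]
  -- The walk stays beyond the edge of `b` from `a` to `b`, so the edge of `a` is farther from the
  -- final vertex. The interval just before `b` does not count for the edge of `a`, and it has
  -- positive length because `d` and `b` differ in colour; this gives strictness.
  · obtain ⟨d, rfl⟩ : ∃ d, b = d + 1 := ⟨b - 1, by omega⟩
    have hs0 := hall a le_rfl hab.le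
    have hs1 := hall (a + 1) (by omega) (by omega)
    have hsub : ∀ v, Separates (height c N) (edge c a) v →
        Separates (height c N) (edge c (d + 1)) v := by
      intro v
      have := edge_cases c a
      have := edge_odd c (d + 1)
      unfold Separates at *
      omega
    have hnot : ¬ Separates (height c N) (edge c a) (height c (d + 1)) := by
      have := edge_cases c a
      have := edge_cases c (d + 1)
      unfold Separates at *
      omega
    have hcd : c d ≠ c (d + 1) := by
      intro hcd
      have he := edge_succ_eq hcd
      have had : a ≠ d := by rintro rfl; exact heab he.symm
      have hd := hall d (by omega) (by omega)
      rw [he] at hbefore hd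
      exact (separates_succ_edge _ _).1 hbefore hd
    have hxd := h.lt d (d + 1) (by omega) hb hcd
    have h1 := h.gapLength_le (edge c a) (show a ≤ d by omega) (by omega)
    have h2 := gapLength_succ (c := c) (x := x) hb (edge c a)
    rw [if_neg hnot] at h2
    have h3 := h.gapLength_mono hsub (d + 1)
    unfold gapAt
    linarith [min_le_right T (gapLength c x N (edge c a) a)]

/-- For particles that are never cancelled, the edges are met in the order of the distance from
the starting point. -/
lemma abs_edge_lt {a b : ℕ} (hab : a < b)
    (ha : ∀ d ≤ a, edge c d = edge c a → ¬ Separates (height c N) (edge c d) (height c (d + 1)))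
    (hb : ∀ d ≤ b, edge c d = edge c b → ¬ Separates (height c N) (edge c d) (height c (d + 1))) :
    |edge c a| < |edge c b| := by
  -- Without an opener on its edge, `b` is the first to cross it, and the walk up to then stays on
  -- the side of `0`.
  have key : ∀ b, (∀ d ≤ b, edge c d = edge c b →
      ¬ Separates (height c N) (edge c d) (height c (d + 1))) →
      ∀ q ≤ b, Separates (height c N) (edge c b) (height c q) := by
    intro b hb q hq
    have h1 : Separates (height c N) (edge c b) (height c b) := by
      by_contra h'; exact hb b le_rfl rfl ((separates_succ_edge _ _).2 h')
    rcases exists_edge_or_forall_separates (edge_odd c b) 0 b (by omega) h1 with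
      ⟨d, -, hd, hde, hds⟩ | h
    · exact absurd (hde ▸ hds) (hb d hd.le hde)
    · exact h q (by omega) hq
  have a0 := key a ha 0 (by omega)
  have b0 := key b hb 0 (by omega)
  have b1 := key b hb a hab.le
  have b2 := key b hb (a + 1) hab
  have hz : height c 0 = 0 := by simp [height]
  rw [hz] at a0 b0
  have := edge_cases c a
  have := edge_odd c b
  unfold Separates at *
  rcases a0 with a0 | a0
  · rw [abs_of_pos (by omega), abs_of_pos (by omega)]; omega
  · rw [abs_of_neg (by omega), abs_of_neg (by omega)]; omega

open Classical in
/-- If a function takes the same value at the two ends of every cancelled gap, then it takes every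
value an even number of times on cancelled particles of a given colour. -/
lemma Sorted.even_card_cancelled (h : Sorted c x N) (T : ℝ) {z : ℕ → ℝ} (p : ℕ) (w : ℝ)
    (hz : ∀ a b, a < b → b < N → edge c a = edge c b → gapAt c x N a < T →
      (∀ q, a < q → q ≤ b → Separates (height c N) (edge c a) (height c q)) → z a = z b) :
    Even (#{i ∈ range N | Cancelled c x N T i ∧ c i = p ∧ z i = w}) := by
  set L := {i ∈ range N | (Cancelled c x N T i ∧ c i = p ∧ z i = w) ∧
    Separates (height c N) (edge c i) (height c (i + 1))} with hL
  set R := {i ∈ range N | (Cancelled c x N T i ∧ c i = p ∧ z i = w) ∧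
    ¬ Separates (height c N) (edge c i) (height c (i + 1))} with hR
  have hgap : ∀ a < N, Cancelled c x N T a → gapAt c x N a < T := by
    rintro a ha ⟨d, hd, he, hs, hg⟩
    refine lt_of_le_of_lt ?_ hg
    unfold gapAt
    rw [he]
    exact h.gapLength_anti _ hd ha
  -- Openers are matched with closers: each opener goes to the next crossing of its edge, which has
  -- the same colour and, by `hz`, the same value of `z`.
  suffices hc : #L = #R by
    have := card_filter_add_card_filter_not (s := {i ∈ range N | Cancelled c x N T i ∧ c i = p ∧ z i = w})
      (fun i => Separates (height c N) (edge c i) (height c (i + 1)))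
    rw [filter_filter, filter_filter, ← hL, ← hR, ← hc] at this
    exact ⟨#L, this.symm⟩
  have hnext : ∀ a ∈ L, ∃ b, (a < b ∧ b < N) ∧ edge c b = edge c a := by
    intro a ha
    simp only [hL, mem_filter, mem_range] at ha
    exact exists_next ha.1 ha.2.2
  have hsep : ∀ a (ha : a ∈ L), ∀ q, a < q → q ≤ Nat.find (hnext a ha) →
      Separates (height c N) (edge c a) (height c q) := by
    intro a ha
    have ha' := ha
    simp only [hL, mem_filter, mem_range] at ha'
    refine forall_separates_of_no_edge (edge_odd c a) ha'.2.2 fun q h1 h2 h3 => ?_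
    exact Nat.find_min (hnext a ha) h2
      ⟨⟨h1, h2.trans (Nat.find_spec (hnext a ha)).1.2⟩, h3⟩
  refine card_bij (fun a ha => Nat.find (hnext a ha)) ?_ ?_ ?_
  · intro a ha
    have hs := hsep a ha
    obtain ⟨⟨h1, h2⟩, h3⟩ := Nat.find_spec (hnext a ha)
    set b := Nat.find (hnext a ha)
    simp only [hL, mem_filter, mem_range] at ha
    simp only [hR, mem_filter, mem_range]
    obtain ⟨haN, ⟨hca, hcp, hzw⟩, has⟩ := ha
    refine ⟨h2, ⟨?_, ?_, ?_⟩, ?_⟩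
    · exact ⟨a, h1.le, h3.symm, has, hgap a haN hca⟩
    · rw [h.colour_eq h3, hcp]
    · rw [← hz a b h1 h2 h3.symm (hgap a haN hca) hs, hzw]
    · rw [separates_succ_edge, not_not, h3]
      exact hs b h1 le_rfl
  · intro a ha a' ha' hEq
    have key : ∀ a ha a' ha', Nat.find (hnext a ha) = Nat.find (hnext a' ha') → ¬ a < a' := by
      intro a ha a' ha' hEq hlt
      have s1 := Nat.find_spec (hnext a ha)
      have s2 := Nat.find_spec (hnext a' ha')
      refine Nat.find_min (hnext a ha) (m := a') (hEq ▸ s2.1.1) ⟨⟨hlt, by omega⟩, ?_⟩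
      rw [← s1.2, ← s2.2, hEq]
    have k1 := key a ha a' ha' hEq
    have k2 := key a' ha' a ha hEq.symm
    omega
  · intro b hb
    simp only [hR, mem_filter, mem_range] at hb
    obtain ⟨hbN, ⟨⟨d, hdb, hde, hds, hdg⟩, hcp, hzw⟩, hbs⟩ := hb
    have hdb : d < b := lt_of_le_of_ne hdb (by rintro rfl; exact hbs hds)
    -- The partner of a closer is the previous crossing of its edge; it is cancelled too, since it
    -- comes no earlier than `d`.
    set a := Nat.findGreatest (fun q => edge c q = edge c b) (b - 1) with ha
    have h1 : edge c a = edge c b :=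
      Nat.findGreatest_spec (P := fun q => edge c q = edge c b) (show d ≤ b - 1 by omega) hde
    have h2 : d ≤ a := Nat.le_findGreatest (by omega) hde
    have h3 : a ≤ b - 1 := Nat.findGreatest_le _
    have h4 : ∀ q, a < q → q < b → edge c q ≠ edge c b := fun q hq hqb =>
      Nat.findGreatest_is_greatest (P := fun q => edge c q = edge c b) hq (by omega)
    have hb0 : Separates (height c N) (edge c b) (height c b) := by
      by_contra h'; exact hbs ((separates_succ_edge _ _).2 h')
    have h5 : ∀ q, a < q → q ≤ b → Separates (height c N) (edge c a) (height c q) := by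
      rcases exists_edge_or_forall_separates (edge_odd c b) (a + 1) b (by omega) hb0 with
        ⟨q, hq1, hq2, hq3, -⟩ | h'
      · exact absurd hq3 (h4 q hq1 hq2)
      · intro q hq1 hq2
        rw [h1]; exact h' q hq1 hq2
    have hca : Cancelled c x N T a := ⟨d, h2, hde.trans h1.symm, hds, hdg⟩
    have haL : a ∈ L := by
      simp only [hL, mem_filter, mem_range]
      refine ⟨by omega, ⟨hca, ?_, ?_⟩, h5 _ (by omega) (by omega)⟩
      · rw [h.colour_eq h1, hcp]
      · rw [hz a b (by omega) hbN h1 (hgap a (by omega) hca) h5, hzw]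
    refine ⟨a, haL, ?_⟩
    rw [Nat.find_eq_iff]
    refine ⟨⟨⟨by omega, hbN⟩, h1.symm⟩, fun q hq hq' => ?_⟩
    exact h4 q hq'.1.1 hq (hq'.2.trans h1)

end ParticleWord

/-! ### Invariance under changes of multiplicity by even numbers -/

namespace ParticleWord

variable {c c' : ℕ → ℕ} {x x' : ℕ → ℝ} {N : ℕ}

/-- The number of particles of colour `p` at `w`. -/
noncomputable def cnt (c : ℕ → ℕ) (x : ℕ → ℝ) (N : ℕ) (p : ℕ) (w : ℝ) : ℕ :=
  #{q ∈ range N | c q = p ∧ x q = w}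

/-- Two lists of coloured particles with the same multiplicities modulo `2`. -/
def ParityEq (c : ℕ → ℕ) (x : ℕ → ℝ) (c' : ℕ → ℕ) (x' : ℕ → ℝ) (N : ℕ) : Prop :=
  ∀ p w, cnt c x N p w ≡ cnt c' x' N p w [MOD 2]

lemma sum_eq_sum_cnt {S : Finset (ℕ × ℝ)} (hS : ∀ q ∈ range N, (c q, x q) ∈ S)
    (F : ℕ → ℝ → ZMod 2) :
    ∑ q ∈ range N, F (c q) (x q) = ∑ y ∈ S, (cnt c x N y.1 y.2 : ZMod 2) * F y.1 y.2 := by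
  rw [← sum_fiberwise_of_maps_to hS]
  refine sum_congr rfl fun y _ => ?_
  have : ∀ q ∈ {q ∈ range N | (c q, x q) = y}, F (c q) (x q) = F y.1 y.2 := by
    intro q hq
    rw [← (mem_filter.1 hq).2]
  rw [sum_congr rfl this, sum_const, nsmul_eq_mul]
  simp only [cnt, Prod.ext_iff]

lemma ParityEq.sum_eq (h : ParityEq c x c' x' N) (F : ℕ → ℝ → ZMod 2) :
    ∑ q ∈ range N, F (c q) (x q) = ∑ q ∈ range N, F (c' q) (x' q) := by
  classical
  set S := (range N).image (fun q => (c q, x q)) ∪ (range N).image (fun q => (c' q, x' q))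
  rw [sum_eq_sum_cnt (S := S) fun q hq => mem_union_left _ (mem_image_of_mem _ hq),
    sum_eq_sum_cnt (S := S) fun q hq => mem_union_right _ (mem_image_of_mem _ hq)]
  refine sum_congr rfl fun y _ => ?_
  rw [(ZMod.natCast_eq_natCast_iff _ _ _).2 (h y.1 y.2)]

/-- The number of particles to the left of `w`. -/
noncomputable def before (x : ℕ → ℝ) (N : ℕ) (w : ℝ) : ℕ := #{q ∈ range N | x q < w}

lemma ParityEq.before_modEq (h : ParityEq c x c' x' N) (w : ℝ) :
    before x N w ≡ before x' N w [MOD 2] := by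
  rw [← ZMod.natCast_eq_natCast_iff, before, before, card_filter, card_filter]
  push_cast
  exact h.sum_eq fun _ y => if y < w then 1 else 0

lemma eq_range_card_of_lower {A : Finset ℕ} (h : ∀ a ∈ A, ∀ b ≤ a, b ∈ A) : A = range #A := by
  refine eq_of_subset_of_card_le (fun a ha => ?_) (by simp)
  have : range (a + 1) ⊆ A := fun b hb => h a ha b (by have := mem_range.1 hb; omega)
  have := card_le_card this
  rw [card_range] at this
  exact mem_range.2 this

lemma Sorted.filter_lt (h : Sorted c x N) (w : ℝ) :
    {q ∈ range N | x q < w} = range (before x N w) := by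
  refine eq_range_card_of_lower fun a ha b hb => ?_
  simp only [mem_filter, mem_range] at ha ⊢
  exact ⟨by omega, (h.mono b a hb ha.1).trans_lt ha.2⟩

lemma Sorted.exists_filter_eq (h : Sorted c x N) (w : ℝ) :
    ∃ m, {q ∈ range N | x q = w} = Ico (before x N w) (before x N w + m) := by
  have h1 : {q ∈ range N | x q ≤ w} = range #{q ∈ range N | x q ≤ w} := by
    refine eq_range_card_of_lower fun a ha b hb => ?_
    simp only [mem_filter, mem_range] at ha ⊢
    exact ⟨by omega, (h.mono b a hb ha.1).trans ha.2⟩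
  have h2 := h.filter_lt w
  set B := #{q ∈ range N | x q ≤ w} with hB
  have hle : before x N w ≤ B :=
    card_le_card fun q hq => by
      simp only [mem_filter] at hq ⊢
      exact ⟨hq.1, hq.2.le⟩
  refine ⟨B - before x N w, ?_⟩
  ext q
  have e1 := Finset.ext_iff.1 h1 q
  have e2 := Finset.ext_iff.1 h2 q
  simp only [mem_filter, mem_range] at e1 e2
  simp only [mem_filter, mem_Ico, mem_range]
  rw [Nat.add_sub_cancel' hle, ← e1, ← not_lt, ← e2]
  constructor
  · rintro ⟨h3, h4⟩
    exact ⟨fun h5 => h5.2.ne h4, h3, h4.le⟩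
  · rintro ⟨h3, h4, h5⟩
    exact ⟨h4, le_antisymm h5 (not_lt.1 fun h6 => h3 ⟨h4, h6⟩)⟩

lemma sum_Ico_neg_one_pow (a m : ℕ) :
    ∑ q ∈ Ico a (a + m), (-1 : ℝ) ^ q = if m % 2 = 1 then (-1) ^ a else 0 := by
  induction m with
  | zero => simp
  | succ m ih =>
    rw [← add_assoc, sum_Ico_succ_top (by omega), ih, pow_add]
    rcases Nat.mod_two_eq_zero_or_one m with hm | hm
    · rw [if_neg (by omega), if_pos (by omega), (Nat.even_iff.2 hm).neg_one_pow]; ring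
    · rw [if_pos hm, if_neg (by omega), (Nat.odd_iff.2 hm).neg_one_pow]; ring

lemma Sorted.colour_unique (h : Sorted c x N) {a b : ℕ} (ha : a < N) (hb : b < N)
    (hab : x a = x b) : c a = c b := by
  by_contra hc
  rcases lt_trichotomy a b with h1 | rfl | h1
  · exact (h.lt a b h1 hb hc).ne hab
  · exact hc rfl
  · exact (h.lt b a h1 ha (Ne.symm hc)).ne hab.symm

/-- Particles at one place share a colour and have consecutive indices, so their alternating signs
cancel in pairs; an odd number leaves the sign of the first. -/
lemma Sorted.signed_sum_fiber (h : Sorted c x N) (F : ℕ → ℝ → ℝ) (w : ℝ) :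
    ∑ q ∈ range N with x q = w, (-1 : ℝ) ^ q * F (c q) (x q) =
      ∑ p ∈ range 2, if cnt c x N p w % 2 = 1 then (-1) ^ before x N w * F p w else 0 := by
  obtain ⟨m, hm⟩ := h.exists_filter_eq w
  have hcnt : ∀ p, cnt c x N p w = #{q ∈ {q ∈ range N | x q = w} | c q = p} := by
    intro p
    rw [cnt, filter_filter]
    congr 1
    ext q
    simp [and_comm]
  rcases Nat.eq_zero_or_pos m with rfl | hpos
  · simp [hcnt, hm]
  have hmem : before x N w ∈ {q ∈ range N | x q = w} := by rw [hm]; simp [hpos]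
  have hcol : ∀ q ∈ {q ∈ range N | x q = w}, c q = c (before x N w) := by
    intro q hq
    simp only [mem_filter, mem_range] at hq hmem
    exact h.colour_unique hq.1 hmem.1 (hq.2.trans hmem.2.symm)
  set c₀ := c (before x N w)
  have h1 : ∀ q ∈ {q ∈ range N | x q = w}, (-1 : ℝ) ^ q * F (c q) (x q) = (-1) ^ q * F c₀ w := by
    intro q hq
    rw [hcol q hq, (mem_filter.1 hq).2]
  have h2 : ∀ p, cnt c x N p w = if p = c₀ then m else 0 := by
    intro p
    rw [hcnt]
    split_ifs with hp
    · rw [filter_true_of_mem fun q hq => (hcol q hq).trans hp.symm, hm]; simp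
    · rw [filter_false_of_mem fun q hq hq' => hp (hq'.symm.trans (hcol q hq))]; simp
  rw [sum_congr rfl h1, ← sum_mul, hm, sum_Ico_neg_one_pow,
    sum_eq_single_of_mem c₀ (mem_range.2 (h.colour _))]
  · rw [h2, if_pos rfl, ite_mul, zero_mul]
  · intro p _ hp
    rw [h2, if_neg hp]; simp

lemma ParityEq.signed_sum_eq (hp : ParityEq c x c' x' N) (h : Sorted c x N) (h' : Sorted c' x' N)
    (F : ℕ → ℝ → ℝ) :
    ∑ q ∈ range N, (-1 : ℝ) ^ q * F (c q) (x q) =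
      ∑ q ∈ range N, (-1 : ℝ) ^ q * F (c' q) (x' q) := by
  classical
  set S := (range N).image x ∪ (range N).image x'
  rw [← sum_fiberwise_of_maps_to (t := S) (g := x)
      fun q hq => mem_union_left _ (mem_image_of_mem _ hq),
    ← sum_fiberwise_of_maps_to (t := S) (g := x')
      fun q hq => mem_union_right _ (mem_image_of_mem _ hq)]
  refine sum_congr rfl fun w _ => ?_
  rw [h.signed_sum_fiber, h'.signed_sum_fiber]
  refine sum_congr rfl fun p _ => ?_
  rw [show cnt c x N p w % 2 = cnt c' x' N p w % 2 from hp p w, neg_one_pow_eq_pow_mod_two,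
    show before x N w % 2 = before x' N w % 2 from hp.before_modEq w,
    ← neg_one_pow_eq_pow_mod_two]

lemma stepSign_cast (c : ℕ → ℕ) (q : ℕ) :
    (stepSign c q : ℝ) = (-1) ^ q * (-1) ^ (1 + c q) := by
  simp [stepSign, pow_add]

lemma ParityEq.height_eq (hp : ParityEq c x c' x' N) (h : Sorted c x N) (h' : Sorted c' x' N) :
    height c N = height c' N := by
  have := hp.signed_sum_eq h h' fun p _ => (-1) ^ (1 + p)
  simp only [← stepSign_cast] at this
  unfold height
  exact_mod_cast this

/-- The edge crossed by an odd number of particles of colour `p` at `w`. -/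
noncomputable def edgeAt (c : ℕ → ℕ) (x : ℕ → ℝ) (N : ℕ) (p : ℕ) (w : ℝ) : ℤ :=
  2 * (∑ q ∈ range N with x q < w, stepSign c q) + (-1) ^ (before x N w + 1 + p)

lemma ParityEq.edgeAt_eq (hp : ParityEq c x c' x' N) (h : Sorted c x N) (h' : Sorted c' x' N) :
    edgeAt c x N = edgeAt c' x' N := by
  ext p w
  have h1 := hp.signed_sum_eq h h' fun p y => if y < w then (-1) ^ (1 + p) else 0
  simp only [mul_ite, mul_zero, ← stepSign_cast, ← sum_filter] at h1
  have h2 : ∑ q ∈ range N with x q < w, stepSign c q =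
      ∑ q ∈ range N with x' q < w, stepSign c' q := by exact_mod_cast h1
  unfold edgeAt
  rw [h2, add_assoc, add_assoc, pow_add, pow_add _ (before x' N w), neg_one_pow_eq_pow_mod_two (before x N w),
    show before x N w % 2 = before x' N w % 2 from hp.before_modEq w,
    ← neg_one_pow_eq_pow_mod_two]

/-- All particles at `x q` cross one edge, and for the first of them, with index `before x N (x q)`,
the formula reads `2 * height + stepSign`. -/
lemma Sorted.edge_eq_edgeAt (h : Sorted c x N) {q : ℕ} (hq : q < N) :
    edge c q = edgeAt c x N (c q) (x q) := by
  have hlt := h.filter_lt (x q)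
  unfold edgeAt
  rw [hlt]
  set a := before x N (x q)
  have haq : a ≤ q := by
    by_contra! hqa
    have : q ∈ {r ∈ range N | x r < x q} := by rw [hlt]; exact mem_range.2 hqa
    exact lt_irrefl _ (mem_filter.1 this).2
  have hx : ∀ r, a ≤ r → r ≤ q → x r = x q := by
    intro r h1 h2
    refine le_antisymm (h.mono r q h2 hq) (not_lt.1 fun h3 => ?_)
    have : r ∈ range a := by rw [← hlt]; exact mem_filter.2 ⟨mem_range.2 (by omega), h3⟩
    have := mem_range.1 this
    omega
  have hc : ∀ r, a ≤ r → r ≤ q → c r = c q := fun r h1 h2 =>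
    h.colour_unique (by omega) hq (hx r h1 h2)
  have he : ∀ r, a ≤ r → r ≤ q → edge c r = edge c a := by
    intro r h1
    induction r, h1 using Nat.le_induction with
    | base => exact fun _ => rfl
    | succ r hr ih =>
      intro h2
      rw [edge_succ_eq ((hc r hr (by omega)).trans (hc (r + 1) (by omega) h2).symm), ih (by omega)]
  rw [he q haq le_rfl, ← hc a le_rfl haq]
  have := height_succ c a
  change _ = 2 * height c a + stepSign c a
  unfold edge
  omega

/-- The indicator of separation drops by `1` when `e` is crossed towards `k` and by `-1` when it is
crossed away from `k`. -/
lemma separates_sub {k e : ℤ} (he : e % 2 = 1) (q : ℕ) :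
    ((if Separates k e (height c q) then 1 else 0) -
      if Separates k e (height c (q + 1)) then 1 else 0 : ℝ) =
      if edge c q = e then (stepSign c q : ℝ) * (2 * k - e).sign else 0 := by
  split_ifs with h1 h2 h3 h3 h2 h3 h3
  all_goals
    have h4 := edge_cases c q
    have h5 := height_succ c q
    unfold Separates at *
  · omega
  · simp
  · rcases h1 with h1 | h1
    · rw [Int.sign_eq_one_of_pos (by omega), show stepSign c q = 1 by omega]; simp
    · rw [Int.sign_eq_neg_one_of_neg (by omega), show stepSign c q = -1 by omega]; simp
  · omega
  · rcases h2 with h2 | h2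
    · rw [Int.sign_eq_one_of_pos (by omega), show stepSign c q = -1 by omega]; simp
    · rw [Int.sign_eq_neg_one_of_neg (by omega), show stepSign c q = 1 by omega]; simp
  · omega
  · omega
  · simp

lemma sum_separates_sub {e : ℤ} (D : ℕ → ℝ)
    (hD : ∀ q, D q = (if Separates (height c N) e (height c q) then 1 else 0) -
      if Separates (height c N) e (height c (q + 1)) then 1 else 0) {i : ℕ} (hi : i ≤ N) :
    ∑ q ∈ Ico i N, D q = if Separates (height c N) e (height c i) then 1 else 0 := by
  have h1 := sum_Ico_sub
    (fun q => if Separates (height c N) e (height c q) then (1 : ℝ) else 0) hi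
  rw [if_neg (not_separates_self _ e)] at h1
  rw [← neg_inj, ← sum_neg_distrib, ← zero_sub (ite _ _ _), ← h1]
  exact sum_congr rfl fun q _ => by rw [hD]; ring

/-- Summation by parts: a sum over intervals becomes a sum over particles, the form to which
`ParityEq.signed_sum_eq` applies. -/
lemma gapLength_eq_sum_Ico {e : ℤ} (D : ℕ → ℝ)
    (hD : ∀ q, D q = (if Separates (height c N) e (height c q) then 1 else 0) -
      if Separates (height c N) e (height c (q + 1)) then 1 else 0) (m : ℕ) :
    ∀ i, i + m + 1 = N → gapLength c x N e i = ∑ q ∈ Ico (i + 1) N, D q * (x q - x i) := by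
  induction m with
  | zero =>
    intro i hi
    simp [gapLength, ← hi]
  | succ m ih =>
    intro i hi
    have h1 := ih (i + 1) (by omega)
    have h2 := sum_separates_sub D hD (show i + 1 ≤ N by omega)
    have h3 : ∑ q ∈ Ico (i + 1) N, D q * (x q - x i) =
        ∑ q ∈ Ico (i + 1) N, D q * (x q - x (i + 1)) +
          (∑ q ∈ Ico (i + 1) N, D q) * (x (i + 1) - x i) := by
      rw [sum_mul, ← sum_add_distrib]
      exact sum_congr rfl fun q _ => by ring
    rw [h3, h2, sum_eq_sum_Ico_succ_bot (show i + 1 < N by omega), sub_self, mul_zero, zero_add,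
      ← h1, gapLength_succ (by omega), ite_mul, one_mul, zero_mul, add_comm]

/-- The gap length to the right of `w`, as a signed sum over all particles. -/
noncomputable def gapSum (c : ℕ → ℕ) (x : ℕ → ℝ) (N : ℕ) (e : ℤ) (w : ℝ) : ℝ :=
  ∑ q ∈ range N, (-1 : ℝ) ^ q * ((-1) ^ (1 + c q) *
    ((if edgeAt c x N (c q) (x q) = e then (2 * height c N - e).sign else 0 : ℤ) *
      max (x q - w) 0))

lemma ParityEq.gapSum_eq (hp : ParityEq c x c' x' N) (h : Sorted c x N) (h' : Sorted c' x' N) :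
    gapSum c x N = gapSum c' x' N := by
  ext e w
  unfold gapSum
  rw [hp.edgeAt_eq h h', hp.height_eq h h']
  exact hp.signed_sum_eq h h' fun p y => (-1) ^ (1 + p) *
    ((if edgeAt c' x' N p y = e then (2 * height c' N - e).sign else 0 : ℤ) * max (y - w) 0)

lemma Sorted.gapAt_eq_gapSum (h : Sorted c x N) {i : ℕ} (hi : i < N) :
    gapAt c x N i = gapSum c x N (edgeAt c x N (c i) (x i)) (x i) := by
  rw [← h.edge_eq_edgeAt hi, gapAt, gapLength_eq_sum_Ico _ (fun q => rfl) (N - 1 - i) i (by omega),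
    gapSum, ← sum_range_add_sum_Ico _ (show i + 1 ≤ N by omega)]
  -- The positive part in `gapSum` removes the particles up to `i`, so the sum may run over all
  -- particles without reference to the index `i`.
  rw [sum_eq_zero (s := range (i + 1)), zero_add]
  · refine sum_congr rfl fun q hq => ?_
    have hq := mem_Ico.1 hq
    rw [separates_sub (edge_odd c i), ← h.edge_eq_edgeAt hq.2,
      max_eq_left (sub_nonneg.2 (h.mono i q (by omega) hq.2))]
    split_ifs
    · rw [stepSign_cast]; ring
    · simp
  · intro q hq
    have hq := mem_range.1 hq
    rw [max_eq_right (sub_nonpos.2 (h.mono q i (by omega) hi))]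
    simp

/-- Moving every particle according to its edge, place and gap length respects the
multiplicities modulo `2`. -/
lemma ParityEq.move (hp : ParityEq c x c' x' N) (h : Sorted c x N) (h' : Sorted c' x' N)
    (Z : ℤ → ℝ → ℝ → ℝ) :
    ParityEq c (fun q => Z (edge c q) (x q) (gapAt c x N q)) c'
      (fun q => Z (edge c' q) (x' q) (gapAt c' x' N q)) N := by
  intro p w
  set Φ : ℕ → ℝ → ZMod 2 := fun r y =>
    if r = p ∧ Z (edgeAt c x N r y) y (gapSum c x N (edgeAt c x N r y) y) = w then 1 else 0
  have key := hp.sum_eq Φ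
  rw [← ZMod.natCast_eq_natCast_iff, cnt, cnt, card_filter, card_filter]
  push_cast
  convert key using 1
  · refine sum_congr rfl fun q hq => ?_
    rw [h.gapAt_eq_gapSum (mem_range.1 hq), h.edge_eq_edgeAt (mem_range.1 hq)]
  · refine sum_congr rfl fun q hq => ?_
    rw [h'.gapAt_eq_gapSum (mem_range.1 hq), h'.edge_eq_edgeAt (mem_range.1 hq),
      ← hp.gapSum_eq h h', ← hp.edgeAt_eq h h']

end ParticleWord

/-! ### The motion in compactified time -/

namespace ParticleWord

/-- The time `g / (1 + |g|)` at which a gap of length `g` closes. -/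
noncomputable def closingTime (g : ℝ) : ℝ := g / (1 + |g|)

/-- The distance covered at time `t` by a particle which travels at most `g`. -/
noncomputable def travel (t g : ℝ) : ℝ :=
  min t (closingTime g) / (1 - min t (closingTime g))

/-- The place at time `(t, s)` of a particle starting at `y` that closes a gap of length `g` and then
moves to `|e|`. -/
noncomputable def motion (t s : ℝ) (e : ℤ) (y g : ℝ) : ℝ := (1 - s) * (y + travel t g) + s * |e|

lemma closingTime_lt_one (g : ℝ) : closingTime g < 1 := by
  unfold closingTime
  rw [div_lt_one (by positivity)]
  linarith [le_abs_self g]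

lemma continuous_closingTime : Continuous closingTime :=
  continuous_id.div (by fun_prop) fun g => by positivity

lemma continuous_travel : Continuous fun p : ℝ × ℝ => travel p.1 p.2 := by
  have h := continuous_closingTime
  unfold travel
  refine Continuous.div (by fun_prop) (by fun_prop) fun p => ?_
  have := min_le_right p.1 (closingTime p.2)
  have := closingTime_lt_one p.2
  linarith

lemma closingTime_mono {g g' : ℝ} (hg : 0 ≤ g) (h : g ≤ g') : closingTime g ≤ closingTime g' := by
  unfold closingTime
  rw [abs_of_nonneg hg, abs_of_nonneg (hg.trans h), div_le_div_iff₀ (by linarith) (by linarith)]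
  linarith

lemma travel_eq_self {t g : ℝ} (hg : 0 ≤ g) (h : closingTime g ≤ t) : travel t g = g := by
  unfold travel
  rw [min_eq_right h, closingTime, abs_of_nonneg hg]
  field_simp
  ring

lemma travel_zero {g : ℝ} (hg : 0 ≤ g) : travel 0 g = 0 := by
  unfold travel
  rw [min_eq_left (by unfold closingTime; positivity), zero_div]

lemma closingTime_lt_iff {t g : ℝ} (ht : t < 1) (hg : 0 ≤ g) :
    closingTime g < t ↔ g < t / (1 - t) := by
  unfold closingTime
  rw [abs_of_nonneg hg, div_lt_iff₀ (by linarith), lt_div_iff₀ (by linarith)]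
  constructor <;> intro h <;> linarith

/-- Time `t < 1` stands for a distance `T = t / (1 - t)`. At `t = 1` all gaps must be closed, and `B
+ 1` serves since only gaps of length at most `B` occur. -/
lemma exists_threshold {t : ℝ} (ht : t ≤ 1) (B : ℝ) :
    ∃ T, ∀ g, 0 ≤ g → g ≤ B → travel t g = min T g ∧ (g < T ↔ closingTime g < t) := by
  rcases ht.lt_or_eq with ht | rfl
  · refine ⟨t / (1 - t), fun g hg _ => ⟨?_, (closingTime_lt_iff ht hg).symm⟩⟩
    rcases lt_or_ge (closingTime g) t with h | h
    · rw [travel_eq_self hg h.le, min_eq_right ((closingTime_lt_iff ht hg).1 h).le]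
    · rw [min_eq_left (not_lt.1 fun h' => h.not_gt ((closingTime_lt_iff ht hg).2 h')), travel,
        min_eq_left h]
  · refine ⟨B + 1, fun g hg hB => ⟨?_, ?_⟩⟩
    · rw [travel_eq_self hg (closingTime_lt_one g).le, min_eq_right (by linarith)]
    · exact iff_of_true (by linarith) (closingTime_lt_one g)

variable {c : ℕ → ℕ} {x : ℕ → ℝ} {N : ℕ}

/-- The place of the `q`-th particle at time `(t, s)`. -/
noncomputable def moved (c : ℕ → ℕ) (x : ℕ → ℝ) (N : ℕ) (t s : ℝ) (q : ℕ) : ℝ :=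
  motion t s (edge c q) (x q) (gapAt c x N q)

lemma Sorted.moved_lt (h : Sorted c x N) {t s T : ℝ} (hs0 : 0 ≤ s) (hs1 : s ≤ 1)
    (hts : s = 0 ∨ t = 1)
    (hT : ∀ q < N, travel t (gapAt c x N q) = min T (gapAt c x N q) ∧
      (gapAt c x N q < T ↔ closingTime (gapAt c x N q) < t))
    {a b : ℕ} (hab : a < b) (hb : b < N) (hc : c a ≠ c b) (hna : ¬ Cancelled c x N T a)
    (hnb : ¬ Cancelled c x N T b) :
    moved c x N t s a < moved c x N t s b := by
  have h1 := h.flow_lt T hab hb hc hnb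
  rw [← (hT a (by omega)).1, ← (hT b hb).1] at h1
  unfold moved motion
  rcases hts with rfl | rfl
  · simpa using h1
  have h2 : |(edge c a : ℝ)| < |(edge c b : ℝ)| := by
    have key : ∀ b < N, ¬ Cancelled c x N T b → ∀ d ≤ b, edge c d = edge c b →
        ¬ Separates (height c N) (edge c d) (height c (d + 1)) := fun b hb hnb d hd he hs =>
      hnb ⟨d, hd, he, hs, (hT d (by omega)).2.2 (closingTime_lt_one _)⟩
    exact_mod_cast abs_edge_lt hab (key a (by omega) hna) (key b hb hnb)
  push_cast
  rcases hs0.eq_or_lt with rfl | hs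
  · simpa using h1
  · have h3 := mul_le_mul_of_nonneg_left h1.le (sub_nonneg.2 hs1)
    have h4 := mul_lt_mul_of_pos_left h2 hs
    linarith

lemma Sorted.gapAt_nonneg (h : Sorted c x N) (q : ℕ) : 0 ≤ gapAt c x N q :=
  h.gapLength_nonneg _ _

/-- The gap length of the closer is at most that of the opener, so both have stopped by time `t`,
and at the same place; afterwards they share the target `|e|`. -/
lemma Sorted.moved_eq (h : Sorted c x N) {t s : ℝ} {a b : ℕ} (hab : a < b) (hb : b < N)
    (he : edge c a = edge c b) (ht : closingTime (gapAt c x N a) < t)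
    (hs : ∀ q, a < q → q ≤ b → Separates (height c N) (edge c a) (height c q)) :
    moved c x N t s a = moved c x N t s b := by
  have h1 := gapLength_eq_of_separates (x := x) hab.le hb hs
  have h2 : gapAt c x N a = x b - x a + gapAt c x N b := by
    unfold gapAt
    rw [h1, he]
  have h3 : gapAt c x N b ≤ gapAt c x N a := by
    have := h.mono a b hab.le hb
    linarith
  have h4 := closingTime_mono (h.gapAt_nonneg b) h3
  unfold moved motion
  rw [travel_eq_self (h.gapAt_nonneg a) ht.le, travel_eq_self (h.gapAt_nonneg b) (h4.trans ht.le),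
    he, h2]
  ring

lemma Sorted.moved_zero (h : Sorted c x N) (q : ℕ) : moved c x N 0 0 q = x q := by
  simp [moved, motion, travel_zero (h.gapAt_nonneg q)]

lemma moved_one (q : ℕ) : moved c x N 1 1 q = |edge c q| := by
  simp [moved, motion]

end ParticleWord

/-! ### The symmetric product as an open quotient of `ℝⁿ` -/

namespace RealDivisor

variable {n : ℕ}

lemma mult_ofTuple (x : Fin n → ℝ) (w : ℝ) : (ofTuple x).mult w = #{i | x i = w} := by
  classical
  unfold mult ofTuple
  rw [Multiset.count_map]
  simp only [Finset.card, Finset.filter, eq_comm]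

lemma mem_support_ofTuple {x : Fin n → ℝ} {w : ℝ} : w ∈ (ofTuple x).support ↔ ∃ i, x i = w := by
  simp [support, mult_ofTuple, Finset.card_pos, Finset.Nonempty]

lemma ofTuple_eq_iff {x y : Fin n → ℝ} : ofTuple x = ofTuple y ↔ ∃ σ : Equiv.Perm (Fin n), x ∘ σ = y := by
  constructor
  · intro h
    have h1 : Multiset.map x univ.val = Multiset.map y univ.val := congrArg Subtype.val h
    have h2 : ∀ w, #{i | x i = w} = #{i | y i = w} := fun w => by
      rw [← mult_ofTuple, ← mult_ofTuple, h]
    have h3 : ∀ w, Nonempty ({i // y i = w} ≃ {i // x i = w}) := fun w =>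
      ⟨Fintype.equivOfCardEq (by rw [Fintype.card_subtype, Fintype.card_subtype, h2])⟩
    let e := fun w => (h3 w).some
    refine ⟨(Equiv.sigmaFiberEquiv y).symm.trans
      ((Equiv.sigmaCongrRight e).trans (Equiv.sigmaFiberEquiv x)), ?_⟩
    ext i
    exact (e (y i) ⟨i, rfl⟩).2
  · rintro ⟨σ, rfl⟩
    apply Subtype.ext
    change Multiset.map x univ.val = Multiset.map (x ∘ σ) univ.val
    rw [← Multiset.map_map]
    congr 1
    exact (congrArg Finset.val (Finset.map_univ_equiv σ)).symm

lemma ofTuple_surjective : Function.Surjective (ofTuple (n := n)) := by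
  rintro ⟨s, hs⟩
  obtain ⟨l, rfl⟩ := Quot.exists_rep s
  have hl : l.length = n := hs
  subst hl
  refine ⟨fun i => l.get i, ?_⟩
  apply Subtype.ext
  change Multiset.map l.get univ.val = (l : Multiset ℝ)
  rw [Fin.univ_def]
  change Multiset.map l.get ((List.finRange l.length : List _) : Multiset _) = _
  rw [Multiset.map_coe, List.map_get_finRange]

/-- Openness matters because open quotient maps, unlike general ones, are stable under products and
restriction to preimages. -/
lemma isOpenQuotientMap_ofTuple : IsOpenQuotientMap (ofTuple (n := n)) where
  surjective := ofTuple_surjective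
  continuous := continuous_coinduced_rng
  isOpenMap := by
    intro V hV
    rw [isOpen_coinduced]
    have : ofTuple ⁻¹' (ofTuple '' V) = ⋃ σ : Equiv.Perm (Fin n), (fun x => x ∘ σ) ⁻¹' V := by
      ext x
      simp only [Set.mem_preimage, Set.mem_image, Set.mem_iUnion, eq_comm (b := ofTuple x),
        ofTuple_eq_iff]
      constructor
      · rintro ⟨y, hy, σ, rfl⟩; exact ⟨σ, hy⟩
      · rintro ⟨σ, h⟩; exact ⟨_, h, σ, rfl⟩
    rw [this]
    exact isOpen_iUnion fun σ => hV.preimage (by fun_prop)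

end RealDivisor

/-! ### Pairs of tuples and a continuity criterion for maps to `T(n,1)` -/

namespace ParticleSpace

open RealDivisor

variable {n : ℕ}

/-- Pairs of `n`-tuples without common entries. -/
def disjointTuples (n : ℕ) : Set (Fin 2 → Fin n → ℝ) := {u | ∀ i j, u 0 i ≠ u 1 j}

lemma isOpen_disjointTuples : IsOpen (disjointTuples n) := by
  unfold disjointTuples
  simp only [Set.ofPred_forall]
  exact isOpen_iInter_of_finite fun i => isOpen_iInter_of_finite fun j =>
    isOpen_ne_fun (by fun_prop) (by fun_prop)

lemma iInter_support_eq_empty_iff {u : Fin 2 → Fin n → ℝ} :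
    ⋂ p, (ofTuple (u p)).support = ∅ ↔ u ∈ disjointTuples n := by
  rw [Set.eq_empty_iff_forall_notMem]
  simp only [Set.mem_iInter, Fin.forall_fin_two, mem_support_ofTuple, disjointTuples,
    Set.mem_ofPred_eq]
  constructor
  · intro h i j hij
    exact h (u 0 i) ⟨⟨i, rfl⟩, j, hij.symm⟩
  · rintro h w ⟨⟨i, rfl⟩, j, hj⟩
    exact h i j hj.symm

/-- The collection of divisors of a pair of tuples. -/
def collectionOf (u : disjointTuples n) : DivisorCollection n 1 :=
  ⟨fun p => ofTuple (u.1 p), iInter_support_eq_empty_iff.2 u.2⟩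

/-- The point of `T(n, 1)` represented by a pair of tuples. -/
def ofTuples (u : disjointTuples n) : ParticleSpace n 1 := Quotient.mk _ (collectionOf u)

lemma isQuotientMap_collectionOf : IsQuotientMap (collectionOf (n := n)) := by
  have h : IsOpenQuotientMap (Pi.map fun _ : Fin (1 + 1) => ofTuple (n := n)) :=
    IsOpenQuotientMap.piMap fun _ => isOpenQuotientMap_ofTuple
  set S : Set (Fin (1 + 1) → RealDivisor n) := {D | ⋂ p, (D p).support = ∅}
  have hpre : (Pi.map fun _ : Fin (1 + 1) => ofTuple (n := n)) ⁻¹' S = disjointTuples n := by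
    ext u
    exact iInter_support_eq_empty_iff
  have h1 : IsOpenQuotientMap (S.restrictPreimage (Pi.map fun _ : Fin (1 + 1) => ofTuple (n := n))) :=
    ⟨Set.restrictPreimage_surjective _ h.surjective, h.continuous.restrictPreimage,
      h.isOpenMap.restrictPreimage _⟩
  exact (h1.comp (Homeomorph.setCongr hpre.symm).isOpenQuotientMap).isQuotientMap

lemma isQuotientMap_ofTuples : IsQuotientMap (ofTuples (n := n)) :=
  IsQuotientMap.comp (isQuotientMap_quotient_mk' (s := mod2Setoid n 1)) isQuotientMap_collectionOf

/-- Two pairs of tuples with the same multiplicities modulo `2`. -/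
def TupleParityEq (u v : Fin 2 → Fin n → ℝ) : Prop :=
  ∀ p w, #{i | u p i = w} ≡ #{i | v p i = w} [MOD 2]

lemma ofTuples_eq_iff {u v : disjointTuples n} : ofTuples u = ofTuples v ↔ TupleParityEq u.1 v.1 := by
  refine (Quotient.eq (r := mod2Setoid n 1)).trans ?_
  unfold TupleParityEq
  change (∀ (p : Fin 2) (x : ℝ), (ofTuple (u.1 p)).mult x ≡ (ofTuple (v.1 p)).mult x [MOD 2]) ↔ _
  simp only [mult_ofTuple]

/-- The odd multiplicities of a pair of tuples are those of a point of `T(n, 1)`. -/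
def Represents (v : Fin 2 → Fin n → ℝ) (ξ : ParticleSpace n 1) : Prop :=
  ∃ u : disjointTuples n, ofTuples u = ξ ∧ TupleParityEq v u.1

lemma Represents.unique {v v' : Fin 2 → Fin n → ℝ} {ξ ξ' : ParticleSpace n 1}
    (h : Represents v ξ) (h' : Represents v' ξ') (hv : TupleParityEq v v') : ξ = ξ' := by
  obtain ⟨u, rfl, hu⟩ := h
  obtain ⟨u', rfl, hu'⟩ := h'
  exact ofTuples_eq_iff.2 fun p w => (hu p w).symm.trans ((hv p w).trans (hu' p w))

open Classical in
lemma even_card_of_even_fibers {s : Finset (Fin n)} {f : Fin n → ℝ}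
    (h : ∀ w, Even (#{i ∈ s | f i = w})) : Even #s := by
  rw [card_eq_sum_card_image f s]
  exact Finset.even_sum _ fun w _ => h w

open Classical in
/-- A continuous family of pairs of tuples defines a family of points of `T(n, 1)` near `z₀` that is
continuous at `z₀` if some entries cancel near `z₀`, and the others of different colours are
distinct at `z₀`. -/
lemma exists_continuousAt_represents {X : Type*} [TopologicalSpace X]
    {f : X → Fin 2 → Fin n → ℝ} (hf : Continuous f) (z₀ : X) (G : Fin 2 → Fin n → Prop)
    (hev : ∀ᶠ z in 𝓝 z₀, ∀ p w, Even (#{i | G p i ∧ f z p i = w}))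
    (hne : ∀ i j, ¬ G 0 i → ¬ G 1 j → f z₀ 0 i ≠ f z₀ 1 j) :
    ∃ F : X → ParticleSpace n 1, ContinuousAt F z₀ ∧ ∀ᶠ z in 𝓝 z₀, Represents (f z) (F z) := by
  set M : ℝ := ∑ p, ∑ i, |f z₀ p i| with hM
  have hle : ∀ p i, f z₀ p i ≤ M := by
    intro p i
    calc f z₀ p i ≤ |f z₀ p i| := le_abs_self _
      _ ≤ ∑ i, |f z₀ p i| := single_le_sum (f := fun i => |f z₀ p i|) (fun _ _ => abs_nonneg _)
        (mem_univ i)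
      _ ≤ M := single_le_sum (f := fun p => ∑ i, |f z₀ p i|)
        (fun _ _ => sum_nonneg fun _ _ => abs_nonneg _) (mem_univ p)
  -- Parking places for the cancelling entries: one per colour, distinct, and beyond all entries at
  -- `z₀`.
  set far : Fin 2 → ℝ := fun p => M + 1 + (p : ℕ)
  set g : X → Fin 2 → Fin n → ℝ := fun z p i => if G p i then far p else f z p i with hg
  have hgc : Continuous g := by
    refine continuous_pi fun p => continuous_pi fun i => ?_
    by_cases h : G p i
    · simp only [hg, if_pos h]; exact continuous_const
    · simp only [hg, if_neg h]; fun_prop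
  have hg0 : g z₀ ∈ disjointTuples n := by
    intro i j
    have h0 := hle 0 i
    have h1 := hle 1 j
    simp only [hg, far]
    split_ifs with hi hj hj
    · simp
    · simp; linarith
    · simp; linarith
    · exact hne i j hi hj
  have hgU : ∀ᶠ z in 𝓝 z₀, g z ∈ disjointTuples n :=
    hgc.continuousAt.eventually (isOpen_disjointTuples.mem_nhds hg0)
  set Q : (Fin 2 → Fin n → ℝ) → ParticleSpace n 1 := fun v =>
    if h : v ∈ disjointTuples n then ofTuples ⟨v, h⟩ else ofTuples ⟨g z₀, hg0⟩ with hQ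
  have hQc : ContinuousOn Q (disjointTuples n) := by
    rw [continuousOn_iff_continuous_domRestrict]
    convert! isQuotientMap_ofTuples.continuous using 1
    ext u
    simp [hQ]
  refine ⟨Q ∘ g, ContinuousAt.comp (hQc.continuousAt (isOpen_disjointTuples.mem_nhds hg0))
    hgc.continuousAt, ?_⟩
  filter_upwards [hgU, hev] with z hz hz'
  refine ⟨⟨g z, hz⟩, by simp only [hQ, Function.comp, dif_pos hz], fun p w => ?_⟩
  have h1 : #{i | f z p i = w} = #{i | G p i ∧ f z p i = w} + #{i | ¬ G p i ∧ f z p i = w} := by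
    rw [← card_filter_add_card_filter_not (s := {i | f z p i = w}) (G p), filter_filter,
      filter_filter]
    simp only [and_comm]
  have h2 : #{i | g z p i = w} = #{i | G p i ∧ far p = w} + #{i | ¬ G p i ∧ f z p i = w} := by
    rw [← card_filter_add_card_filter_not (s := {i | g z p i = w}) (G p), filter_filter,
      filter_filter]
    congr 2
    · ext i; simp only [hg, mem_filter, mem_univ, true_and]
      constructor
      · rintro ⟨h, h'⟩; exact ⟨h', by simpa [h'] using h⟩
      · rintro ⟨h, h'⟩; exact ⟨by simpa [h] using h', h⟩
    · ext i; simp only [hg, mem_filter, mem_univ, true_and]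
      constructor
      · rintro ⟨h, h'⟩; exact ⟨h', by simpa [h'] using h⟩
      · rintro ⟨h, h'⟩; exact ⟨by simpa [h] using h', h⟩
  -- Even numbers at each place give an even total, so parking the cancelling entries together
  -- changes no multiplicity modulo 2.
  have h3 : Even (#{i | G p i ∧ far p = w}) := by
    by_cases hw : far p = w
    · simp only [hw, and_true]
      refine even_card_of_even_fibers (f := f z p) fun w => ?_
      rw [filter_filter]
      exact hz' p w
    · simp [hw]
  change _ ≡ #{i | g z p i = w} [MOD 2]
  rw [h1, h2]
  refine Nat.ModEq.add_right _ ?_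
  have h4 := Nat.even_iff.1 (hz' p w)
  have h5 := Nat.even_iff.1 h3
  exact h4.trans h5.symm

end ParticleSpace

/-! ### The homotopy on `T(n,1)` -/

namespace ParticleSpace

open RealDivisor ParticleWord

variable {n : ℕ}

/-- An enumeration of the entries of a pair of `n`-tuples. -/
abbrev Enumeration (n : ℕ) : Type := Fin (2 * n) ≃ Fin 2 × Fin n

/-- The colour of the `q`-th particle in an enumeration. -/
def word (π : Enumeration n) (q : ℕ) : ℕ := if h : q < 2 * n then (π ⟨q, h⟩).1 else 0

/-- The place of the `q`-th particle in an enumeration. -/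
def place (π : Enumeration n) (u : Fin 2 → Fin n → ℝ) (q : ℕ) : ℝ :=
  if h : q < 2 * n then u (π ⟨q, h⟩).1 (π ⟨q, h⟩).2 else 0

/-- The pair of tuples with prescribed places of particles. -/
def arrange (π : Enumeration n) (z : ℕ → ℝ) : Fin 2 → Fin n → ℝ := fun p i => z (π.symm (p, i))

/-- The pairs of tuples without common entries that are sorted by a given enumeration. -/
def sortedTuples (π : Enumeration n) : Set (Fin 2 → Fin n → ℝ) :=
  {u | u ∈ disjointTuples n ∧ Monotone fun q : Fin (2 * n) => u (π q).1 (π q).2}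

lemma disjoint_of_ne {u : Fin 2 → Fin n → ℝ} (hu : u ∈ disjointTuples n) {p r : Fin 2} (hpr : p ≠ r)
    (i j : Fin n) : u p i ≠ u r j := by
  fin_cases p <;> fin_cases r
  · exact absurd rfl hpr
  · exact hu i j
  · exact (hu j i).symm
  · exact absurd rfl hpr

lemma sorted_word (π : Enumeration n) {u : Fin 2 → Fin n → ℝ} (hu : u ∈ sortedTuples π) :
    Sorted (word π) (place π u) (2 * n) where
  mono a b hab hb := by
    simp only [place, dif_pos hb, dif_pos (hab.trans_lt hb)]
    exact hu.2 (show (⟨a, _⟩ : Fin (2 * n)) ≤ ⟨b, _⟩ from hab)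
  lt a b hab hb hc := by
    simp only [place, word, dif_pos hb, dif_pos (hab.trans hb)] at hc ⊢
    refine lt_of_le_of_ne (hu.2 (show (⟨a, _⟩ : Fin (2 * n)) ≤ ⟨b, _⟩ from hab.le)) ?_
    exact disjoint_of_ne hu.1 (fun h => hc (congrArg Fin.val h)) _ _
  colour a := by
    unfold word
    split_ifs
    · exact Fin.is_lt _
    · norm_num

lemma cnt_word (π : Enumeration n) (z : ℕ → ℝ) (P : ℕ → Prop) [DecidablePred P] (p : Fin 2) (w : ℝ) :
    #{q ∈ range (2 * n) | P q ∧ word π q = p ∧ z q = w} =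
      #{i | P (π.symm (p, i)) ∧ arrange π z p i = w} := by
  symm
  refine card_bij (fun i _ => (π.symm (p, i) : ℕ)) ?_ ?_ ?_
  · intro i hi
    simp only [mem_filter, mem_univ, true_and, mem_range] at hi ⊢
    exact ⟨Fin.is_lt _, hi.1, by simp [word], hi.2⟩
  · intro i _ j _ hij
    simpa using π.symm.injective (Fin.ext hij)
  · intro q hq
    simp only [mem_filter, mem_range] at hq
    obtain ⟨hqN, hP, hw, hz⟩ := hq
    rw [word, dif_pos hqN] at hw
    have hp : (p, (π ⟨q, hqN⟩).2) = π ⟨q, hqN⟩ := Prod.ext (Fin.ext hw).symm rfl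
    have hpq : (π.symm (p, (π ⟨q, hqN⟩).2) : ℕ) = q := by rw [hp, Equiv.symm_apply_apply]
    refine ⟨(π ⟨q, hqN⟩).2, mem_filter.2 ⟨mem_univ _, ?_⟩, hpq⟩
    unfold arrange
    rw [hpq]
    exact ⟨hP, hz⟩

lemma cnt_word_eq (π : Enumeration n) (z : ℕ → ℝ) (p : Fin 2) (w : ℝ) :
    cnt (word π) z (2 * n) p w = #{i | arrange π z p i = w} := by
  simpa [cnt] using cnt_word π z (fun _ => True) p w

lemma arrange_place (π : Enumeration n) (u : Fin 2 → Fin n → ℝ) : arrange π (place π u) = u := by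
  ext p i
  simp [arrange, place]

lemma parityEq_iff (π π' : Enumeration n) (z z' : ℕ → ℝ) :
    ParityEq (word π) z (word π') z' (2 * n) ↔ TupleParityEq (arrange π z) (arrange π' z') := by
  constructor
  · intro h p w
    rw [← cnt_word_eq, ← cnt_word_eq]
    exact h p w
  · intro h p w
    by_cases hp : p < 2
    · have := h ⟨p, hp⟩ w
      rwa [← cnt_word_eq, ← cnt_word_eq] at this
    · have h0 : ∀ (ρ : Enumeration n) y, cnt (word ρ) y (2 * n) p w = 0 := by
        intro ρ y
        refine card_eq_zero.2 (filter_false_of_mem fun q hq hq' => hp ?_)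
        rw [← hq'.1, word, dif_pos (mem_range.1 hq)]
        exact Fin.is_lt _
      rw [h0, h0]

lemma exists_sorting (u : Fin 2 → Fin n → ℝ) :
    ∃ π : Enumeration n, Monotone fun q : Fin (2 * n) => u (π q).1 (π q).2 := by
  set f : Fin (2 * n) → ℝ := fun q => u (finProdFinEquiv.symm q).1 (finProdFinEquiv.symm q).2
  exact ⟨(Tuple.sort f).trans finProdFinEquiv.symm, Tuple.monotone_sort f⟩

/-- The point of `T(n, 1)` represented by a sorted pair of tuples. -/
def ofSorted (y : Σ π : Enumeration n, sortedTuples π) : ParticleSpace n 1 :=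
  ofTuples ⟨y.2.1, y.2.2.1⟩

/-- The sorted pieces form a finite closed cover of the pairs of tuples. On each piece the word is
fixed, so the motion is given by one continuous formula. -/
lemma isQuotientMap_ofSorted : IsQuotientMap (ofSorted (n := n)) := by
  set f : (Σ π : Enumeration n, sortedTuples π) → disjointTuples n := fun y => ⟨y.2.1, y.2.2.1⟩
  have hf : Continuous f := by
    refine continuous_sigma fun π => ?_
    exact continuous_subtype_val.subtype_mk _
  have hcl : IsClosedMap f := by
    suffices h : ∀ π, IsClosedMap fun u : sortedTuples π => f ⟨π, u⟩ by
      intro s hs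
      have : f '' s = ⋃ π, (fun u : sortedTuples π => f ⟨π, u⟩) '' ((fun u => ⟨π, u⟩) ⁻¹' s) := by
        ext u
        simp only [Set.mem_image, Set.mem_iUnion, Sigma.exists, Set.mem_preimage]
      rw [this]
      exact isClosed_iUnion_of_finite fun π => h π _ (hs.preimage continuous_sigmaMk)
    intro π
    have hC : IsClosed {u : disjointTuples n | Monotone fun q : Fin (2 * n) => u.1 (π q).1 (π q).2} := by
      simp only [Monotone, Set.ofPred_forall]
      refine isClosed_iInter fun a => isClosed_iInter fun b => isClosed_iInter fun _ => ?_
      have h1 : ∀ q, Continuous fun u : disjointTuples n => u.1 (π q).1 (π q).2 := fun q =>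
        (continuous_apply_apply _ _).comp continuous_subtype_val
      exact isClosed_le (h1 a) (h1 b)
    intro s hs
    obtain ⟨t, ht, rfl⟩ := isClosed_induced_iff.1 hs
    have : (fun x : sortedTuples π => f ⟨π, x⟩) '' (Subtype.val ⁻¹' t) =
        (Subtype.val ⁻¹' t : Set (disjointTuples n)) ∩
          {u | Monotone fun q : Fin (2 * n) => u.1 (π q).1 (π q).2} := by
      ext u
      constructor
      · rintro ⟨y, hy, rfl⟩
        exact ⟨hy, y.2.2⟩
      · rintro ⟨h1, h2⟩
        exact ⟨⟨u.1, u.2, h2⟩, h1, rfl⟩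
    rw [this]
    exact (ht.preimage continuous_subtype_val).inter hC
  have hsurj : Function.Surjective f := by
    intro u
    obtain ⟨π, hπ⟩ := exists_sorting u.1
    exact ⟨⟨π, u.1, u.2, hπ⟩, rfl⟩
  exact isQuotientMap_ofTuples.comp (hcl.isQuotientMap hf hsurj)

/-- The configuration at time `(t, s)` of the motion that starts at `u`. -/
noncomputable def moveTuples (π : Enumeration n) (u : Fin 2 → Fin n → ℝ) (t s : ℝ) :
    Fin 2 → Fin n → ℝ :=
  arrange π (moved (word π) (place π u) (2 * n) t s)

lemma continuous_place (π : Enumeration n) (q : ℕ) : Continuous fun u => place π u q := by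
  unfold place
  split_ifs <;> fun_prop

lemma continuous_gapAt (π : Enumeration n) (q : ℕ) :
    Continuous fun u => gapAt (word π) (place π u) (2 * n) q := by
  unfold gapAt gapLength
  refine continuous_finsetSum _ fun r _ => ?_
  split_ifs
  · exact (continuous_place π _).sub (continuous_place π _)
  · exact continuous_const

lemma continuous_moveTuples (π : Enumeration n) :
    Continuous fun y : (Fin 2 → Fin n → ℝ) × ℝ × ℝ => moveTuples π y.1 y.2.1 y.2.2 := by
  refine continuous_pi fun p => continuous_pi fun i => ?_
  unfold moveTuples arrange moved motion
  have h1 := (continuous_place π (π.symm (p, i))).comp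
    (continuous_fst (X := Fin 2 → Fin n → ℝ) (Y := ℝ × ℝ))
  have h2 := continuous_travel.comp ((continuous_fst.comp continuous_snd).prodMk
    ((continuous_gapAt π (π.symm (p, i))).comp
      (continuous_fst (X := Fin 2 → Fin n → ℝ) (Y := ℝ × ℝ))))
  exact ((continuous_const.sub (by fun_prop)).mul (h1.add h2)).add
    ((by fun_prop : Continuous fun y : (Fin 2 → Fin n → ℝ) × ℝ × ℝ => y.2.2).mul continuous_const)

open unitInterval

/-- The time for closing gaps during the first half of the motion. -/
noncomputable def gapTime (τ : I) : ℝ := min (2 * (τ : ℝ)) 1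

/-- The time for moving to the final places during the second half of the motion. -/
noncomputable def lineTime (τ : I) : ℝ := max (2 * (τ : ℝ) - 1) 0

lemma lineTime_eq_zero_or (τ : I) : lineTime τ = 0 ∨ gapTime τ = 1 := by
  unfold lineTime gapTime
  rcases le_total (2 * (τ : ℝ)) 1 with h | h
  · left; exact max_eq_right (by linarith)
  · right; exact min_eq_right h

lemma lineTime_le_one (τ : I) : lineTime τ ≤ 1 :=
  max_le (by linarith [τ.2.2]) zero_le_one

/-- The motion of sorted pairs of tuples. -/
noncomputable def sortedMotion (π : Enumeration n) (y : sortedTuples π × I) : Fin 2 → Fin n → ℝ :=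
  moveTuples π y.1.1 (gapTime y.2) (lineTime y.2)

lemma continuous_sortedMotion (π : Enumeration n) : Continuous (sortedMotion π) := by
  unfold sortedMotion gapTime lineTime
  exact (continuous_moveTuples π).comp (f := fun y : sortedTuples π × I =>
    (y.1.1, min (2 * (y.2 : ℝ)) 1, max (2 * (y.2 : ℝ) - 1) 0)) (by fun_prop)

lemma exists_continuousAt_sortedMotion (π : Enumeration n) (y₀ : sortedTuples π × I) :
    ∃ F : sortedTuples π × I → ParticleSpace n 1, ContinuousAt F y₀ ∧
      ∀ᶠ y in 𝓝 y₀, Represents (sortedMotion π y) (F y) := by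
  classical
  obtain ⟨⟨u₀, hu₀⟩, τ₀⟩ := y₀
  have h := sorted_word π hu₀
  obtain ⟨T, hT⟩ := exists_threshold (t := gapTime τ₀) (min_le_right _ _)
    (∑ q ∈ range (2 * n), gapAt (word π) (place π u₀) (2 * n) q)
  replace hT : ∀ q < 2 * n, _ := fun q hq => hT _ (h.gapAt_nonneg q)
    (single_le_sum (f := gapAt (word π) (place π u₀) (2 * n)) (fun r _ => h.gapAt_nonneg r)
      (mem_range.2 hq))
  refine exists_continuousAt_represents (continuous_sortedMotion π) _
    (fun p i => Cancelled (word π) (place π u₀) (2 * n) T (π.symm (p, i))) ?_ ?_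
  -- Cancellation is defined by a strict inequality, so gaps closed before time `τ₀` at `u₀` remain
  -- closed nearby, and the same set of cancelled indices works for all nearby points.
  · have hnear : ∀ᶠ y : sortedTuples π × I in 𝓝 (⟨u₀, hu₀⟩, τ₀), ∀ a ∈ range (2 * n),
        gapAt (word π) (place π u₀) (2 * n) a < T →
          closingTime (gapAt (word π) (place π y.1.1) (2 * n) a) < gapTime y.2 := by
      rw [Filter.eventually_all_finset]
      intro a ha
      rw [Filter.eventually_imp_distrib_left]
      intro hlt
      have h1 : Continuous fun y : sortedTuples π × I =>
          closingTime (gapAt (word π) (place π y.1.1) (2 * n) a) :=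
        continuous_closingTime.comp ((continuous_gapAt π a).comp
          (continuous_subtype_val.comp continuous_fst))
      have h2 : Continuous fun y : sortedTuples π × I => gapTime y.2 := by
        unfold gapTime; fun_prop
      exact h1.continuousAt.eventually_lt h2.continuousAt ((hT a (mem_range.1 ha)).2.1 hlt)
    filter_upwards [hnear] with y hy p w
    rw [sortedMotion, moveTuples, ← cnt_word]
    refine h.even_card_cancelled T p w fun a b hab hb he ha hs => ?_
    exact (sorted_word π y.1.2).moved_eq hab hb he (hy a (mem_range.2 (hab.trans hb)) ha) hs
  · intro i j hi hj
    have hc : word π (π.symm (0, i)) ≠ word π (π.symm (1, j)) := by simp [word]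
    have hts := lineTime_eq_zero_or τ₀
    have hs0 : 0 ≤ lineTime τ₀ := le_max_right _ _
    have hs1 := lineTime_le_one τ₀
    change moved _ _ _ _ _ _ ≠ moved _ _ _ _ _ _
    rcases lt_trichotomy (π.symm (0, i) : ℕ) (π.symm (1, j)) with hlt | heq | hlt
    · exact (h.moved_lt hs0 hs1 hts hT hlt (Fin.is_lt _) hc hi hj).ne
    · exact absurd (congrArg (word π) heq) hc
    · exact (h.moved_lt hs0 hs1 hts hT hlt (Fin.is_lt _) hc.symm hj hi).ne'

lemma exists_homotopy (ξ : ParticleSpace n 1) (τ : I) : ∃ η : ParticleSpace n 1,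
    ∃ y : Σ π : Enumeration n, sortedTuples π, ofSorted y = ξ ∧
      Represents (sortedMotion y.1 (y.2, τ)) η := by
  obtain ⟨y, hy⟩ := isQuotientMap_ofSorted.surjective ξ
  obtain ⟨F, -, hF⟩ := exists_continuousAt_sortedMotion y.1 (y.2, τ)
  exact ⟨_, y, hy, hF.self_of_nhds⟩

/-- The motion of points of `T(n, 1)`. -/
noncomputable def homotopy (ξ : ParticleSpace n 1) (τ : I) : ParticleSpace n 1 :=
  (exists_homotopy ξ τ).choose

lemma homotopy_eq_of_represents (y : Σ π : Enumeration n, sortedTuples π) (τ : I)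
    (η : ParticleSpace n 1) (h : Represents (sortedMotion y.1 (y.2, τ)) η) :
    homotopy (ofSorted y) τ = η := by
  obtain ⟨y', hy', hr⟩ := (exists_homotopy (ofSorted y) τ).choose_spec
  refine hr.unique h ?_
  have h1 : TupleParityEq y'.2.1 y.2.1 := ofTuples_eq_iff.1 hy'
  rw [← arrange_place y'.1 y'.2.1, ← arrange_place y.1 y.2.1, ← parityEq_iff] at h1
  exact (parityEq_iff _ _ _ _).1 (h1.move (sorted_word y'.1 y'.2.2) (sorted_word y.1 y.2.2)
    (motion (gapTime τ) (lineTime τ)))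

/-- Continuity can be tested on the sorted pieces times `I`, since `I` is locally compact; there the
homotopy agrees near each point with a map continuous at that point. -/
lemma continuous_homotopy : Continuous fun y : ParticleSpace n 1 × I => homotopy y.1 y.2 := by
  refine isQuotientMap_ofSorted.continuous_lift_prod_left
    (g := fun y : ParticleSpace n 1 × I => homotopy y.1 y.2) ?_
  rw [← (Homeomorph.sigmaProdDistrib (X := fun π : Enumeration n => sortedTuples π)
    (Y := I)).symm.comp_continuous_iff']
  refine continuous_sigma fun π => continuous_iff_continuousAt.2 fun y₀ => ?_
  obtain ⟨F, hF, hr⟩ := exists_continuousAt_sortedMotion π y₀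
  refine hF.congr ?_
  filter_upwards [hr] with y hy
  exact (homotopy_eq_of_represents ⟨π, y.1⟩ y.2 _ hy).symm

lemma homotopy_zero (ξ : ParticleSpace n 1) : homotopy ξ 0 = ξ := by
  obtain ⟨y, rfl⟩ := isQuotientMap_ofSorted.surjective ξ
  refine homotopy_eq_of_represents y 0 _ ⟨⟨y.2.1, y.2.2.1⟩, rfl, ?_⟩
  have h0 : sortedMotion y.1 (y.2, 0) = y.2.1 := by
    have : moved (word y.1) (place y.1 y.2.1) (2 * n) 0 0 = place y.1 y.2.1 :=
      funext (sorted_word y.1 y.2.2).moved_zero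
    simp [sortedMotion, moveTuples, gapTime, lineTime, this, arrange_place]
  rw [h0]
  exact fun _ _ => rfl

/-- At time `1` each particle is at `|edge|`, which depends on the enumeration alone. So the final
map is constant on each sorted piece, and preimages of arbitrary sets are unions of whole pieces. -/
lemma isLocallyConstant_homotopy_one :
    IsLocallyConstant fun ξ : ParticleSpace n 1 => homotopy ξ 1 := by
  have hc : ∀ (π : Enumeration n) (u v : sortedTuples π),
      homotopy (ofSorted ⟨π, u⟩) 1 = homotopy (ofSorted ⟨π, v⟩) 1 := by
    intro π u v
    obtain ⟨F, -, hF⟩ := exists_continuousAt_sortedMotion π (v, 1)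
    have h2 := hF.self_of_nhds
    rw [homotopy_eq_of_represents ⟨π, v⟩ 1 _ h2]
    refine homotopy_eq_of_represents ⟨π, u⟩ 1 _ ?_
    have h1 : ∀ u : sortedTuples π,
        sortedMotion π (u, 1) = arrange π fun q => ((|edge (word π) q| : ℤ) : ℝ) := by
      intro u
      ext p i
      norm_num [sortedMotion, moveTuples, gapTime, lineTime, arrange, moved_one]
    rw [h1] at h2 ⊢
    exact h2
  intro s
  rw [← isQuotientMap_ofSorted.isOpen_preimage, isOpen_sigma_iff]
  intro π
  by_cases h : ∃ u : sortedTuples π, homotopy (ofSorted ⟨π, u⟩) 1 ∈ s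
  · obtain ⟨u, hu⟩ := h
    convert isOpen_univ
    exact Set.eq_univ_of_forall fun v => show homotopy (ofSorted ⟨π, v⟩) 1 ∈ s from hc π u v ▸ hu
  · convert isOpen_empty
    exact Set.eq_empty_of_forall_notMem fun v hv => h ⟨v, hv⟩

/-- The path of `ζ` starts at `ζ` and is connected, so the homotopy restricts to each component. -/
lemma homotopy_mem_connectedComponent {ξ ζ : ParticleSpace n 1} (h : ζ ∈ connectedComponent ξ)
    (τ : I) : homotopy ζ τ ∈ connectedComponent ξ := by
  rw [connectedComponent_eq h]
  have hcont : Continuous fun θ : I => homotopy ζ θ :=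
    continuous_homotopy.comp (continuous_const.prodMk continuous_id)
  refine (isPreconnected_range hcont).subset_connectedComponent ⟨0, homotopy_zero ζ⟩ ⟨τ, rfl⟩

end ParticleSpace

open ParticleSpace in
theorem mainTheorem7 (n : ℕ) (ξ : ParticleSpace n 1) :
    ContractibleSpace (connectedComponent ξ) := by
  rw [contractible_iff_id_nullhomotopic]
  refine ⟨⟨homotopy ξ 1, homotopy_mem_connectedComponent mem_connectedComponent 1⟩, ⟨?_⟩⟩
  exact
    { toFun := fun y => ⟨homotopy y.2.1 y.1, homotopy_mem_connectedComponent y.2.2 y.1⟩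
      continuous_toFun := (continuous_homotopy.comp
        (f := fun y : unitInterval × connectedComponent ξ => (y.2.1, y.1))
        (by fun_prop)).subtype_mk _
      map_zero_left := fun ζ => Subtype.ext (homotopy_zero ζ.1)
      map_one_left := fun ζ => Subtype.ext (isLocallyConstant_homotopy_one.apply_eq_of_isPreconnected
        isPreconnected_connectedComponent ζ.2 mem_connectedComponent) }
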